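/- **Theorem 5.11 (Type II Hamilton–Jacobi theorem for a $\mathbf J$-nonholonomic $R_o$-reduced distributional RCH system).** *Setting.* Let $Q$ be a smooth $n$-dimensional manifold, $\pi_Q:T^*Q\to Q$ its cotangent bundle with the canonical symplectic form $\omega=dq^i\wedge dp_i$; the Hamiltonian vector field $X_f$ of a function $f$ is given by $\mathbf i_{X_f}\omega=\mathbf df$. Let a Lie group $G$ with Lie algebra $\mathfrak g$ act smoothly from the left on $Q$ such that the cotangent lifted action on $T^*Q$ is symplectic, free and proper, with an $\mathrm{Ad}^*$-equivariant momentum map $\mathbf J:T^*Q\to\mathfrak g^*$, so $\mathbf d\langle\mathbf J,\xi\rangle=\mathbf i_{\xi_{T^*Q}}\omega$ for $\xi\in\mathfrak g$. Let $\mathcal D\subset TQ$ be a $G$-invariant completely nonholonomic (bracket-generating) distribution, $L:TQ\to\mathbb R$ a smooth hyperregular and $\mathcal D$-regular Lagrangian (the Legendre transformation $\mathcal FL:TQ\to T^*Q$ is a diffeomorphism, and at points of $\mathcal D$ the fibre Hessian of $L$ is non-degenerate on $\mathcal D$), and $H:T^*Q\to\mathbb R$ the associated Hamiltonian, which is $G$-invariant.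 Let $F:T^*Q\to T^*Q$ be a smooth $G$-equivariant fibre-preserving map (external force), $W\subset T^*Q$ a $G$-invariant control subset, and $u:T^*Q\to W$ a smooth fibre-preserving map (control law). *Distributional system.* Put $\mathcal M=\mathcal FL(\mathcal D)$, $\mathcal F=(T\pi_Q)^{-1}(\mathcal D)$ and $\mathcal K=\mathcal F\cap T\mathcal M$. Assume that the restriction $\omega_{\mathcal K}$ of $\omega$ to $\mathcal K$ is non-degenerate, and let $\tau_{\mathcal K}$ be the $\omega$-orthogonal projection of $T(T^*Q)|_{\mathcal M}$ to $\mathcal K$. Let $X_{\mathcal K}$ be the vector field on $\mathcal M$ with values in $\mathcal K$ that solves $\mathbf i_{X_{\mathcal K}}\omega_{\mathcal K}=\mathbf dH|_{\mathcal K}$. For a fibre-preserving map $A$ let $\mathrm{vlift}(A)X_H(\alpha)$ be the vertical part (for a fixed connection on $T^*Q\to Q$) of $TA(X_H(\alpha))\in T_{A(\alpha)}T^*Q$, moved parallelly from $A(\alpha)$ to $\alpha$ along the straight line in the fibre. Put $F_{\mathcal K}=\tau_{\mathcal K}\,\mathrm{vlift}(F)X_H$, $u_{\mathcal K}=\tau_{\mathcal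 K}\,\mathrm{vlift}(u)X_H$ and $\tilde X=X_{\mathcal K}+F_{\mathcal K}+u_{\mathcal K}$ on $\mathcal M$. *Reduced system.* Let $\mu\in\mathfrak g^*$ be a regular value of $\mathbf J$ with coadjoint orbit $\mathcal O_\mu$; assume $F(\mathbf J^{-1}(\mathcal O_\mu))\subset\mathbf J^{-1}(\mathcal O_\mu)$, $W\cap\mathbf J^{-1}(\mathcal O_\mu)\ne\emptyset$ and $\mathcal M\cap\mathbf J^{-1}(\mathcal O_\mu)\neq\emptyset$. Let $i:\mathbf J^{-1}(\mathcal O_\mu)\to T^*Q$ be the inclusion of the (initial) submanifold $\mathbf J^{-1}(\mathcal O_\mu)$, $\pi:\mathbf J^{-1}(\mathcal O_\mu)\to(T^*Q)_{\mathcal O_\mu}=\mathbf J^{-1}(\mathcal O_\mu)/G$ the projection to the quotient manifold (a submersion), $\omega_{\mathcal O_\mu}$ the reduced symplectic form, characterized by $i^*\omega=\pi^*\omega_{\mathcal O_\mu}+(\mathbf J\circ i)^*\omega^+_{\mathcal O_\mu}$ with $\omega^+_{\mathcal O_\mu}(\nu)(\xi_{\mathfrak g^*}(\nu),\eta_{\mathfrak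 g^*}(\nu))=\langle\nu,[\xi,\eta]\rangle$, and $h$ the reduced Hamiltonian, $h\circ\pi=H\circ i$. Put $\mathcal M_{\mathcal O_\mu}=(\mathcal M\cap\mathbf J^{-1}(\mathcal O_\mu))/G$, $\mathcal F_{\mathcal O_\mu}=T\pi(\mathcal F\cap T\mathbf J^{-1}(\mathcal O_\mu))$ and $\mathcal K_{\mathcal O_\mu}=\mathcal F_{\mathcal O_\mu}\cap T\mathcal M_{\mathcal O_\mu}$. Assume that the restriction $\omega_{\mathcal K_{\mathcal O_\mu}}$ of $\omega_{\mathcal O_\mu}$ to $\mathcal K_{\mathcal O_\mu}$ is non-degenerate, let $\tau_{\mathcal K_{\mathcal O_\mu}}$ be the $\omega_{\mathcal O_\mu}$-orthogonal projection to $\mathcal K_{\mathcal O_\mu}$, and let $X_{\mathcal K_{\mathcal O_\mu}}$ be the vector field on $\mathcal M_{\mathcal O_\mu}$ with values in $\mathcal K_{\mathcal O_\mu}$ that solves $\mathbf i_{X_{\mathcal K_{\mathcal O_\mu}}}\omega_{\mathcal K_{\mathcal O_\mu}}=\mathbf dh|_{\mathcal K_{\mathcal O_\mu}}$. *Maps.*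 Let $\gamma:Q\to T^*Q$ be a smooth $G$-invariant one-form ($\gamma(gq)=g\cdot\gamma(q)$) with $\mathrm{Im}(\gamma)\subset\mathcal M\cap\mathbf J^{-1}(\mathcal O_\mu)$ (for instance $\mathrm{Im}(\gamma)\subset\mathcal M\cap\mathbf J^{-1}(\mu)$), and put $\lambda=\gamma\circ\pi_Q$, $\bar\gamma_{\mathcal O_\mu}=\pi\circ\gamma:Q\to\mathcal M_{\mathcal O_\mu}$, $\bar\lambda_{\mathcal O_\mu}=\pi\circ\lambda$; assume $\mathrm{Im}(T\bar\gamma_{\mathcal O_\mu})\subset\mathcal K_{\mathcal O_\mu}$. Let $\varepsilon:T^*Q\to T^*Q$ be a smooth symplectic map ($\varepsilon^*\omega=\omega$) that commutes with the action of $G$ and satisfies $\varepsilon(\mathcal M\cap\mathbf J^{-1}(\mathcal O_\mu))\subset\mathcal M\cap\mathbf J^{-1}(\mathcal O_\mu)$. Put $\bar\varepsilon_{\mathcal O_\mu}=\pi\circ\varepsilon$ and $\tilde X^\varepsilon=T\pi_Q\cdot\tilde X\cdot\varepsilon$. Let $X_{h\circ\bar\varepsilon_{\mathcal O_\mu}}$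 be the Hamiltonian vector field on $(T^*Q,\omega)$ of any smooth function on $T^*Q$ that equals $h\circ\pi\circ\varepsilon$ on $\varepsilon^{-1}(\mathbf J^{-1}(\mathcal O_\mu))$ (for instance of $H\circ\varepsilon$), and let $T\bar\varepsilon_{\mathcal O_\mu}\cdot X_{h\circ\bar\varepsilon_{\mathcal O_\mu}}=T\pi\cdot(T\varepsilon\cdot X_{h\circ\bar\varepsilon_{\mathcal O_\mu}})$, where the first equation below includes the claim that $T\varepsilon\cdot X_{h\circ\bar\varepsilon_{\mathcal O_\mu}}$ is tangent to $\mathbf J^{-1}(\mathcal O_\mu)$. *Conclusion.* The equation $$\tau_{\mathcal K_{\mathcal O_\mu}}\cdot T\bar\varepsilon_{\mathcal O_\mu}\cdot X_{h\circ\bar\varepsilon_{\mathcal O_\mu}}=T\bar\lambda_{\mathcal O_\mu}\cdot\tilde X\cdot\varepsilon$$ holds at all points of $\mathcal M\cap\mathbf J^{-1}(\mathcal O_\mu)$ if and only if the Type II Hamilton–Jacobi equation $$T\bar\gamma_{\mathcal O_\mu}\cdot\tilde X^\varepsilon=X_{\mathcal K_{\mathcal O_\mu}}\cdot\bar\varepsilon_{\mathcal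 O_\mu}$$ holds at all points of $\mathcal M\cap\mathbf J^{-1}(\mathcal O_\mu)$; both are equations in the tangent bundle of $(T^*Q)_{\mathcal O_\mu}$, base points included. -/

import Mathlib

open scoped Manifold ContDiff Topology Bundle

noncomputable section

namespace NonholonomicRCH

/-! ## Generic notions -/

section Generic

/-- The projection `τ_K` of a vector `v` to the subspace `K`, orthogonally with respect to the
bilinear form `B`: the element `k` of `K` with `B k w = B v w` for all `w ∈ K`.  It exists and is
unique when `V` is finite dimensional and `B` is non-degenerate on `K` (then `V = K ⊕ K^⊥`). -/
def formProjection {V : Type*} [AddCommGroup V] [Module ℝ V] (B : V → V → ℝ)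
    (K : Submodule ℝ V) (v : V) : V :=
  open Classical in
  if h : ∃ k : V, k ∈ K ∧ ∀ w ∈ K, B k w = B v w then h.choose else 0

/-- `B` is non-degenerate as a bilinear form on `K`. -/
def NondegenerateOn {V : Type*} [AddCommGroup V] [Module ℝ V] (B : V → V → ℝ)
    (K : Submodule ℝ V) : Prop :=
  ∀ k ∈ K, (∀ w ∈ K, B k w = 0) → k = 0

variable {V : Type*} [NormedAddCommGroup V] [NormedSpace ℝ V]
  {N : Type*} [TopologicalSpace N] {H : Type*} [TopologicalSpace H] [ChartedSpace H N]

/-- The tangent space at `x` of a subset `A` of a manifold: the linear span of the velocities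
at `x` of the smooth curves that stay in `A`.  For an embedded (or initial) submanifold this is
the usual tangent space. -/
def tangentOf (I : ModelWithCorners ℝ V H) (A : Set N) (x : N) :
    Submodule ℝ (TangentSpace I x) :=
  Submodule.span ℝ {v | ∃ c : ℝ → N, ContMDiff 𝓘(ℝ, ℝ) I ∞ c ∧ (∀ t, c t ∈ A) ∧
    (⟨c 0, mfderiv 𝓘(ℝ, ℝ) I c 0 (1 : ℝ)⟩ : TangentBundle I N) = ⟨x, v⟩}

end Generic

/-! ## Distributions on the configuration manifold -/

section Configuration

variable {E : Type*} [NormedAddCommGroup E] [NormedSpace ℝ E]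
  {Q : Type*} [TopologicalSpace Q] [ChartedSpace E Q] [IsManifold 𝓘(ℝ, E) ∞ Q]

/-- A smooth distribution (subbundle of `TQ`) of some constant rank `k`. -/
def IsSmoothDistribution (D : ∀ q : Q, Submodule ℝ (TangentSpace 𝓘(ℝ, E) q)) : Prop :=
  ∃ k : ℕ, ∀ q : Q, ∃ U : Set Q, IsOpen U ∧ q ∈ U ∧
    ∃ X : Fin k → ∀ x : Q, TangentSpace 𝓘(ℝ, E) x,
      (∀ i, ContMDiffOn 𝓘(ℝ, E) 𝓘(ℝ, E).tangent ∞
        (fun x => (⟨x, X i x⟩ : TangentBundle 𝓘(ℝ, E) Q)) U) ∧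
      ∀ x ∈ U, LinearIndependent ℝ (fun i => X i x) ∧
        Submodule.span ℝ (Set.range fun i => X i x) = D x

/-- `X` is, over the open set `U`, a smooth vector field with values in `D`. -/
def IsLocalSection (D : ∀ q : Q, Submodule ℝ (TangentSpace 𝓘(ℝ, E) q)) (U : Set Q)
    (X : ∀ x : Q, TangentSpace 𝓘(ℝ, E) x) : Prop :=
  ContMDiffOn 𝓘(ℝ, E) 𝓘(ℝ, E).tangent ∞ (fun x => (⟨x, X x⟩ : TangentBundle 𝓘(ℝ, E) Q)) U ∧
    ∀ x ∈ U, X x ∈ D x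

/-- The iterated Lie brackets `X₁`, `[X₁, X₂]`, `[X₁, [X₂, X₃]]`, … over `U` of sections of `D`. -/
inductive IteratedBracket (D : ∀ q : Q, Submodule ℝ (TangentSpace 𝓘(ℝ, E) q)) (U : Set Q) :
    (∀ x : Q, TangentSpace 𝓘(ℝ, E) x) → Prop
  | base (X : ∀ x : Q, TangentSpace 𝓘(ℝ, E) x) (hX : IsLocalSection D U X) :
      IteratedBracket D U X
  | bracket (X Y : ∀ x : Q, TangentSpace 𝓘(ℝ, E) x) (hX : IsLocalSection D U X)
      (hY : IteratedBracket D U Y) :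
      IteratedBracket D U (VectorField.mlieBracket 𝓘(ℝ, E) X Y)

/-- `D` is completely nonholonomic: together with its iterated Lie brackets it spans `TQ`. -/
def IsCompletelyNonholonomic (D : ∀ q : Q, Submodule ℝ (TangentSpace 𝓘(ℝ, E) q)) : Prop :=
  ∀ q : Q, Submodule.span ℝ {v : TangentSpace 𝓘(ℝ, E) q |
    ∃ (U : Set Q) (X : ∀ x : Q, TangentSpace 𝓘(ℝ, E) x),
      IsOpen U ∧ q ∈ U ∧ IteratedBracket D U X ∧ X q = v} = ⊤

end Configuration

/-! ## The cotangent bundle and its canonical symplectic form -/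

section Cotangent

variable (E : Type*) [NormedAddCommGroup E] [NormedSpace ℝ E]
  (Q : Type*) [TopologicalSpace Q] [ChartedSpace E Q]

/-- The cotangent bundle `T*Q`, with the smooth structure that Mathlib puts on it as the bundle
of continuous linear maps from `TQ` to the trivial line bundle. -/
abbrev Cotangent : Type _ :=
  Bundle.TotalSpace (E →L[ℝ] ℝ)
    (fun q : Q => TangentSpace 𝓘(ℝ, E) q →L[ℝ] Bundle.Trivial Q ℝ q)

/-- The model with corners of `T*Q`. -/
abbrev cotModel : ModelWithCorners ℝ (E × (E →L[ℝ] ℝ)) (ModelProd E (E →L[ℝ] ℝ)) :=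
  𝓘(ℝ, E).prod 𝓘(ℝ, E →L[ℝ] ℝ)

variable {E Q} [IsManifold 𝓘(ℝ, E) ∞ Q]

/-- The projection `π_Q : T*Q → Q`. -/
def cotProj (z : Cotangent E Q) : Q := z.proj

/-- `Tπ_Q : T_z T*Q → T_q Q`. -/
def cotProjDeriv (z : Cotangent E Q) :
    TangentSpace (cotModel E) z →L[ℝ] TangentSpace 𝓘(ℝ, E) (cotProj z) :=
  mfderiv (cotModel E) 𝓘(ℝ, E) cotProj z

/-- The coordinates `(δq, δp)` of a tangent vector of `T*Q` at `z`, in the canonical cotangent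
coordinates `(q, p)` induced by the preferred chart of `Q` at `π_Q z`.  (Mathlib's tangent space
at `z` consists of such pairs, by definition, and these coordinates are the preferred chart of
`T*Q` at `z`.) -/
def canonicalCoords (z : Cotangent E Q) (v : TangentSpace (cotModel E) z) :
    E × (E →L[ℝ] ℝ) := v

/-- The canonical symplectic form `ω = dqⁱ ∧ dpᵢ` of `T*Q`. -/
def canonicalForm (z : Cotangent E Q) (v w : TangentSpace (cotModel E) z) : ℝ :=
  (canonicalCoords z w).2 (canonicalCoords z v).1 -
    (canonicalCoords z v).2 (canonicalCoords z w).1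

/-- `X` is the Hamiltonian vector field of `f`: `i_X ω = df`. -/
def IsHamiltonianField (f : Cotangent E Q → ℝ)
    (X : ∀ z : Cotangent E Q, TangentSpace (cotModel E) z) : Prop :=
  ∀ (z : Cotangent E Q) (w : TangentSpace (cotModel E) z),
    canonicalForm z (X z) w = mfderiv (cotModel E) 𝓘(ℝ, ℝ) f z w

/-- A smooth map `ε : T*Q → T*Q` is symplectic if `ε^*ω = ω`. -/
def IsSymplecticMap (ε : Cotangent E Q → Cotangent E Q) : Prop :=
  ContMDiff (cotModel E) (cotModel E) ∞ ε ∧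
    ∀ (z : Cotangent E Q) (v w : TangentSpace (cotModel E) z),
      canonicalForm (ε z) (mfderiv (cotModel E) (cotModel E) ε z v)
        (mfderiv (cotModel E) (cotModel E) ε z w) = canonicalForm z v w

/-- A smooth fiber-preserving map `T*Q → T*Q`. -/
def IsFiberPreserving (F : Cotangent E Q → Cotangent E Q) : Prop :=
  ContMDiff (cotModel E) (cotModel E) ∞ F ∧ ∀ z, cotProj (F z) = cotProj z

variable (E Q) in
/-- An (Ehresmann) connection on `T*Q → Q`, given by its projection `v ↦ v^v` of `T_z T*Q` onto
the vertical space `ker T_z π_Q`. -/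
structure VerticalPart where
  /-- the vertical part of a tangent vector -/
  ver : ∀ z : Cotangent E Q, TangentSpace (cotModel E) z →L[ℝ] TangentSpace (cotModel E) z
  vertical : ∀ z v, cotProjDeriv z (ver z v) = 0
  eq_self : ∀ z v, cotProjDeriv z v = 0 → ver z v = v

/-- The change `vlift(F) X` of a vector field `X` under a fiber-preserving map `F`: at `z`, the
vertical part of `TF(X z)`, a vector at `F z`, moved parallelly to `z` along the straight line in
the fiber that joins `F z` to `z`.  As `F z` and `z` lie in one fiber, their canonical coordinates
are the same ones, and the parallel transport of a vertical vector `(0, δp)` is `(0, δp)`. -/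
def vlift (C : VerticalPart E Q) (F : Cotangent E Q → Cotangent E Q)
    (X : ∀ z : Cotangent E Q, TangentSpace (cotModel E) z) (z : Cotangent E Q) :
    TangentSpace (cotModel E) z :=
  ((0, (canonicalCoords (F z)
    (C.ver (F z) (mfderiv (cotModel E) (cotModel E) F z (X z)))).2) : E × (E →L[ℝ] ℝ))

/-- The map `Q → T*Q` given by a one-form `γ`. -/
def formMap (γ : ∀ q : Q, TangentSpace 𝓘(ℝ, E) q →L[ℝ] ℝ) (q : Q) : Cotangent E Q := ⟨q, γ q⟩

/-- The fiber derivative (Legendre transformation) `FL : TQ → T*Q` of `L`. -/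
def legendre (L : TangentBundle 𝓘(ℝ, E) Q → ℝ) (v : TangentBundle 𝓘(ℝ, E) Q) : Cotangent E Q :=
  ⟨v.proj, fderiv ℝ (fun w : E => L ⟨v.proj, w⟩) v.snd⟩

/-- The fiber Hessian `∂²L/∂q̇ⁱ∂q̇ʲ` of `L` at `v`. -/
def fiberHessian (L : TangentBundle 𝓘(ℝ, E) Q → ℝ) (v : TangentBundle 𝓘(ℝ, E) Q) :
    E →L[ℝ] E →L[ℝ] ℝ :=
  fderiv ℝ (fun w : E => fderiv ℝ (fun w' : E => L ⟨v.proj, w'⟩) w) v.snd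

/-- `L` is `D`-regular: at the points of `D`, its fiber Hessian is non-degenerate on `D`. -/
def IsRegularOn (L : TangentBundle 𝓘(ℝ, E) Q → ℝ)
    (D : ∀ q : Q, Submodule ℝ (TangentSpace 𝓘(ℝ, E) q)) : Prop :=
  ∀ (q : Q), ∀ v ∈ D q, NondegenerateOn (fun a b : TangentSpace 𝓘(ℝ, E) q =>
    fiberHessian L ⟨q, v⟩ a b) (D q)

/-- The constraint submanifold `M = FL(D)`. -/
def constraintSet (L : TangentBundle 𝓘(ℝ, E) Q → ℝ)
    (D : ∀ q : Q, Submodule ℝ (TangentSpace 𝓘(ℝ, E) q)) : Set (Cotangent E Q) :=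
  legendre L '' {v | v.snd ∈ D v.proj}

/-- The distribution `𝓕 = (Tπ_Q)⁻¹(D)`. -/
def pullbackDistribution (D : ∀ q : Q, Submodule ℝ (TangentSpace 𝓘(ℝ, E) q))
    (z : Cotangent E Q) : Submodule ℝ (TangentSpace (cotModel E) z) :=
  (D (cotProj z)).comap (cotProjDeriv z).toLinearMap

/-- The distribution `𝓚 = 𝓕 ∩ TM` along `M`. -/
def constraintDistribution (L : TangentBundle 𝓘(ℝ, E) Q → ℝ)
    (D : ∀ q : Q, Submodule ℝ (TangentSpace 𝓘(ℝ, E) q)) (z : Cotangent E Q) :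
    Submodule ℝ (TangentSpace (cotModel E) z) :=
  pullbackDistribution D z ⊓ tangentOf (cotModel E) (constraintSet L D) z

end Cotangent

/-! ## Symmetry, momentum map, and the objects of orbit reduction -/

section Symmetry

variable {E : Type*} [NormedAddCommGroup E] [NormedSpace ℝ E]
  {Q : Type*} [TopologicalSpace Q] [ChartedSpace E Q] [IsManifold 𝓘(ℝ, E) ∞ Q]
  {EG : Type*} [NormedAddCommGroup EG] [NormedSpace ℝ EG]
  {G : Type*} [Group G] [TopologicalSpace G] [ChartedSpace EG G] [MulAction G Q]

/-- The tangent lifted action `v ↦ T_q g v` of `g` on `TQ`. -/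
def tangentLift (g : G) (q : Q) :
    TangentSpace 𝓘(ℝ, E) q →L[ℝ] TangentSpace 𝓘(ℝ, E) (g • q) :=
  mfderiv 𝓘(ℝ, E) 𝓘(ℝ, E) (fun x : Q => g • x) q

/-- The cotangent lifted left action `α ↦ α ∘ (T_q g)⁻¹` of `g` on `T*Q`. -/
def cotLift (g : G) (z : Cotangent E Q) : Cotangent E Q :=
  ⟨g • z.proj, z.snd.comp (tangentLift g z.proj).inverse⟩

/-- The infinitesimal generator `ξ_{T*Q}` at `z` of `ξ ∈ 𝔤 = T_1 G`: the velocity at `g = 1`, in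
the direction `ξ`, of the orbit map `g ↦ g · z` (and `1 · z = z`). -/
def generator (ξ : GroupLieAlgebra 𝓘(ℝ, EG) G) (z : Cotangent E Q) :
    TangentSpace (cotModel E) z :=
  mfderiv 𝓘(ℝ, EG) (cotModel E) (fun g : G => cotLift g z) 1 ξ

/-- The adjoint action `Ad_g` on `𝔤 = T_1 G`. -/
def adjoint (g : G) : EG →L[ℝ] EG :=
  mfderiv 𝓘(ℝ, EG) 𝓘(ℝ, EG) (fun h : G => g * h * g⁻¹) 1

/-- The coadjoint left action `ν ↦ Ad^*_{g⁻¹} ν = ν ∘ Ad_{g⁻¹}` of `G` on `𝔤^*`. -/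
def coadjoint (g : G) (ν : EG →L[ℝ] ℝ) : EG →L[ℝ] ℝ := ν.comp (adjoint g⁻¹)

variable (G) in
/-- The coadjoint orbit `𝒪_μ`. -/
def coadjointOrbit (μ : EG →L[ℝ] ℝ) : Set (EG →L[ℝ] ℝ) := Set.range fun g : G => coadjoint g μ

/-- The infinitesimal generator `ξ_{𝔤^*}(ν)` of the coadjoint action. -/
def coadjointGenerator (ξ : GroupLieAlgebra 𝓘(ℝ, EG) G) (ν : EG →L[ℝ] ℝ) : EG →L[ℝ] ℝ :=
  mfderiv 𝓘(ℝ, EG) 𝓘(ℝ, EG →L[ℝ] ℝ) (fun g : G => coadjoint g ν) 1 ξ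

/-- The value `ω⁺(ν)(ξ_{𝔤^*}(ν), η_{𝔤^*}(ν)) = ⟨ν, [ξ, η]⟩` of the `+`-symplectic form of the
coadjoint orbit through `ν`. -/
def orbitForm (ν : EG →L[ℝ] ℝ) (ξ η : GroupLieAlgebra 𝓘(ℝ, EG) G) : ℝ :=
  ν (⁅ξ, η⁆ : GroupLieAlgebra 𝓘(ℝ, EG) G)

/-- `TJ`, as a map from `T_z T*Q` to `𝔤^*`. -/
def momentumDeriv (J : Cotangent E Q → (EG →L[ℝ] ℝ)) (z : Cotangent E Q)
    (v : TangentSpace (cotModel E) z) : EG →L[ℝ] ℝ :=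
  mfderiv (cotModel E) 𝓘(ℝ, EG →L[ℝ] ℝ) J z v

variable (E Q EG G) in
/-- A nonholonomic RCH system with symmetry and momentum map
`(T*Q, G, ω, J, D, H, F, W)`, where `ω` is the canonical symplectic form. -/
structure NonholonomicSystem where
  /-- the momentum map -/
  J : Cotangent E Q → (EG →L[ℝ] ℝ)
  /-- the nonholonomic constraint -/
  D : ∀ q : Q, Submodule ℝ (TangentSpace 𝓘(ℝ, E) q)
  /-- the Lagrangian -/
  L : TangentBundle 𝓘(ℝ, E) Q → ℝ
  /-- the Hamiltonian -/
  H : Cotangent E Q → ℝ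
  /-- the external force map -/
  F : Cotangent E Q → Cotangent E Q
  /-- the control subset -/
  W : Set (Cotangent E Q)
  -- the cotangent lifted action is smooth, symplectic, free and proper
  lift_smooth : ContMDiff (𝓘(ℝ, EG).prod (cotModel E)) (cotModel E) ∞
    (fun p : G × Cotangent E Q => cotLift p.1 p.2)
  lift_symplectic : ∀ g : G, IsSymplecticMap (cotLift g : Cotangent E Q → Cotangent E Q)
  lift_free : ∀ (g : G) (z : Cotangent E Q), cotLift g z = z → g = 1
  lift_proper : IsProperMap (fun p : G × Cotangent E Q => (cotLift p.1 p.2, p.2))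
  -- `J` is an `Ad^*`-equivariant momentum map
  J_smooth : ContMDiff (cotModel E) 𝓘(ℝ, EG →L[ℝ] ℝ) ∞ J
  J_momentum : ∀ (ξ : GroupLieAlgebra 𝓘(ℝ, EG) G) (z : Cotangent E Q)
    (v : TangentSpace (cotModel E) z), momentumDeriv J z v ξ = canonicalForm z (generator ξ z) v
  J_equivariant : ∀ (g : G) (z : Cotangent E Q), J (cotLift g z) = coadjoint g (J z)
  -- `D` is a completely nonholonomic distribution
  D_smooth : IsSmoothDistribution D
  D_complete : IsCompletelyNonholonomic D
  -- `L` is hyperregular and `D`-regular, and `H` is the associated Hamiltonian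
  L_smooth : ContMDiff 𝓘(ℝ, E).tangent 𝓘(ℝ, ℝ) ∞ L
  L_hyperregular : ∃ Φ : Diffeomorph 𝓘(ℝ, E).tangent (cotModel E) (TangentBundle 𝓘(ℝ, E) Q)
    (Cotangent E Q) ∞, ∀ v, Φ v = legendre L v
  L_regular : IsRegularOn L D
  H_smooth : ContMDiff (cotModel E) 𝓘(ℝ, ℝ) ∞ H
  H_legendre : ∀ v : TangentBundle 𝓘(ℝ, E) Q,
    H (legendre L v) = (legendre L v).snd v.snd - L v
  F_fiber : IsFiberPreserving F
  -- `D`, `H`, `F` and `W` are `G`-invariant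
  D_invariant : ∀ (g : G) (q : Q), ∀ v ∈ D q, tangentLift g q v ∈ D (g • q)
  H_invariant : ∀ (g : G) (z : Cotangent E Q), H (cotLift g z) = H z
  F_invariant : ∀ (g : G) (z : Cotangent E Q), F (cotLift g z) = cotLift g (F z)
  W_invariant : ∀ (g : G), ∀ z ∈ W, cotLift g z ∈ W

variable (G) in
/-- `μ` is a regular value of the momentum map. -/
def IsRegularValue (J : Cotangent E Q → (EG →L[ℝ] ℝ)) (μ : EG →L[ℝ] ℝ) : Prop :=
  ∀ z : Cotangent E Q, J z = μ → ∀ ν : EG →L[ℝ] ℝ, ∃ v, momentumDeriv J z v = ν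

variable (G) in
/-- The set `J⁻¹(𝒪_μ)`, as a type of its own.  (It gets its own topology and smooth structure,
as the orbit need not be locally closed.) -/
structure OrbitLevel (J : Cotangent E Q → (EG →L[ℝ] ℝ)) (μ : EG →L[ℝ] ℝ) where
  /-- the inclusion `i : J⁻¹(𝒪_μ) → T*Q` -/
  pt : Cotangent E Q
  mem : J pt ∈ coadjointOrbit G μ

variable (G) in
/-- The orbit space `(T*Q)_{𝒪_μ} = J⁻¹(𝒪_μ)/G`. -/
def OrbitReduced (J : Cotangent E Q → (EG →L[ℝ] ℝ)) (μ : EG →L[ℝ] ℝ) : Type _ :=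
  Quot fun s t : OrbitLevel G J μ => ∃ g : G, t.pt = cotLift g s.pt

/-- The projection `π : J⁻¹(𝒪_μ) → (T*Q)_{𝒪_μ}`. -/
def orbitProj {J : Cotangent E Q → (EG →L[ℝ] ℝ)} {μ : EG →L[ℝ] ℝ} (s : OrbitLevel G J μ) :
    OrbitReduced G J μ := Quot.mk _ s

/-- The reduced function `h : (T*Q)_{𝒪_μ} → ℝ` of an invariant function `H`: `h ∘ π = H ∘ i`. -/
def reducedFunction {J : Cotangent E Q → (EG →L[ℝ] ℝ)} {μ : EG →L[ℝ] ℝ} (H : Cotangent E Q → ℝ)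
    (hH : ∀ (g : G) (z : Cotangent E Q), H (cotLift g z) = H z) : OrbitReduced G J μ → ℝ :=
  Quot.lift (fun s => H s.pt) (by
    rintro s t ⟨g, hg⟩
    simp only [hg, hH])

section Level

variable {J : Cotangent E Q → (EG →L[ℝ] ℝ)} {μ : EG →L[ℝ] ℝ}
  {ES : Type*} [NormedAddCommGroup ES] [NormedSpace ℝ ES]
  [TopologicalSpace (OrbitLevel G J μ)] [ChartedSpace ES (OrbitLevel G J μ)]

/-- `Ti : T_s J⁻¹(𝒪_μ) → T_{i s} T*Q`. -/
def inclDeriv (s : OrbitLevel G J μ) :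
    TangentSpace 𝓘(ℝ, ES) s →L[ℝ] TangentSpace (cotModel E) s.pt :=
  mfderiv 𝓘(ℝ, ES) (cotModel E) OrbitLevel.pt s

variable (G J μ ES) in
/-- The smooth structure given on `J⁻¹(𝒪_μ)` is that of an (initial) submanifold of `T*Q` with
tangent spaces `(TJ)⁻¹(T𝒪_μ)`.  There is only one such smooth structure. -/
structure IsLevelSubmanifold : Prop where
  immersion : Manifold.IsImmersion 𝓘(ℝ, ES) (cotModel E) ∞
    (OrbitLevel.pt : OrbitLevel G J μ → Cotangent E Q)
  -- a map into `J⁻¹(𝒪_μ)` that is smooth as a map into `T*Q` is smooth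
  initial : ∀ (k : ℕ) (U : Set (EuclideanSpace ℝ (Fin k))), IsOpen U →
    ∀ f : EuclideanSpace ℝ (Fin k) → OrbitLevel G J μ,
      ContMDiffOn 𝓘(ℝ, EuclideanSpace ℝ (Fin k)) (cotModel E) ∞ (fun x => (f x).pt) U →
        ContMDiffOn 𝓘(ℝ, EuclideanSpace ℝ (Fin k)) 𝓘(ℝ, ES) ∞ f U
  tangent : ∀ (s : OrbitLevel G J μ) (v : TangentSpace (cotModel E) s.pt),
    (∃ u, inclDeriv (ES := ES) s u = v) ↔
      ∃ ξ : GroupLieAlgebra 𝓘(ℝ, EG) G, momentumDeriv J s.pt v = coadjointGenerator ξ (J s.pt)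

variable {EP : Type*} [NormedAddCommGroup EP] [NormedSpace ℝ EP]
  [TopologicalSpace (OrbitReduced G J μ)] [ChartedSpace EP (OrbitReduced G J μ)]

/-- `Tπ : T_s J⁻¹(𝒪_μ) → T_{π s} (T*Q)_{𝒪_μ}`. -/
def orbitProjDeriv (s : OrbitLevel G J μ) :
    TangentSpace 𝓘(ℝ, ES) s →L[ℝ] TangentSpace 𝓘(ℝ, EP) (orbitProj s) :=
  mfderiv 𝓘(ℝ, ES) 𝓘(ℝ, EP) orbitProj s

variable (ES) in
/-- `ωO` is the reduced form on `(T*Q)_{𝒪_μ}`, the one with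
`i^*ω = π^*ωO + J_{𝒪_μ}^* ω⁺`, where `J_{𝒪_μ} = J ∘ i`. -/
def IsReducedForm (ωO : ∀ y : OrbitReduced G J μ,
    TangentSpace 𝓘(ℝ, EP) y →L[ℝ] TangentSpace 𝓘(ℝ, EP) y →L[ℝ] ℝ) : Prop :=
  ∀ (s : OrbitLevel G J μ) (v w : TangentSpace 𝓘(ℝ, ES) s)
    (ξ η : GroupLieAlgebra 𝓘(ℝ, EG) G),
    momentumDeriv J s.pt (inclDeriv s v) = coadjointGenerator ξ (J s.pt) →
    momentumDeriv J s.pt (inclDeriv s w) = coadjointGenerator η (J s.pt) →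
      canonicalForm s.pt (inclDeriv s v) (inclDeriv s w) =
        ωO (orbitProj s) (orbitProjDeriv s v) (orbitProjDeriv s w) + orbitForm (J s.pt) ξ η

end Level

namespace NonholonomicSystem

variable (S : NonholonomicSystem E Q EG G)

/-- The constraint submanifold `M = FL(D)` of the system. -/
def M : Set (Cotangent E Q) := constraintSet S.L S.D

/-- The distribution `𝓚 = (Tπ_Q)⁻¹(D) ∩ TM`. -/
def K (z : Cotangent E Q) : Submodule ℝ (TangentSpace (cotModel E) z) :=
  constraintDistribution S.L S.D z

/-- `M ∩ J⁻¹(𝒪_μ)`. -/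
def constraintLevel (μ : EG →L[ℝ] ℝ) : Set (Cotangent E Q) :=
  {z | z ∈ S.M ∧ S.J z ∈ coadjointOrbit G μ}

/-- The smooth fiber-preserving maps `u : T*Q → W`, that is, the control laws. -/
def IsControlLaw (u : Cotangent E Q → Cotangent E Q) : Prop :=
  IsFiberPreserving u ∧ ∀ z, u z ∈ S.W

/-- `X_𝓚` is the nonholonomic dynamical vector field: it takes values in `𝓚` and solves the
distributional Hamiltonian equation `i_{X_𝓚} ω_𝓚 = dH_𝓚` along `M`. -/
def IsNonholonomicField (X : ∀ z : Cotangent E Q, TangentSpace (cotModel E) z) : Prop :=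
  ∀ z ∈ S.M, X z ∈ S.K z ∧
    ∀ w ∈ S.K z, canonicalForm z (X z) w = mfderiv (cotModel E) 𝓘(ℝ, ℝ) S.H z w

/-- The projection `τ_𝓚 : T_z T*Q → 𝓚_z`. -/
def tauK (z : Cotangent E Q) (v : TangentSpace (cotModel E) z) : TangentSpace (cotModel E) z :=
  formProjection (canonicalForm z) (S.K z) v

/-- The dynamical vector field `X̃ = X_𝓚 + F_𝓚 + u_𝓚` of the distributional RCH system, where
`F_𝓚 = τ_𝓚 (vlift(F_M) X_H)` and `u_𝓚 = τ_𝓚 (vlift(u_M) X_H)`. -/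
def dynamicalField (C : VerticalPart E Q) (u : Cotangent E Q → Cotangent E Q)
    (XH XK : ∀ z : Cotangent E Q, TangentSpace (cotModel E) z) (z : Cotangent E Q) :
    TangentSpace (cotModel E) z :=
  XK z + S.tauK z (vlift C S.F XH z) + S.tauK z (vlift C u XH z)

/-- The reduced constraint submanifold `M_{𝒪_μ} = (M ∩ J⁻¹(𝒪_μ))/G ⊆ (T*Q)_{𝒪_μ}`. -/
def reducedM (μ : EG →L[ℝ] ℝ) : Set (OrbitReduced G S.J μ) :=
  orbitProj '' {s | s.pt ∈ S.M}

variable {μ : EG →L[ℝ] ℝ}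
  (ES : Type*) [NormedAddCommGroup ES] [NormedSpace ℝ ES]
  [TopologicalSpace (OrbitLevel G S.J μ)] [ChartedSpace ES (OrbitLevel G S.J μ)]
  {EP : Type*} [NormedAddCommGroup EP] [NormedSpace ℝ EP]
  [TopologicalSpace (OrbitReduced G S.J μ)] [ChartedSpace EP (OrbitReduced G S.J μ)]

/-- The pushed down distribution `𝓕_{𝒪_μ} = Tπ(𝓕)`, that is, `Tπ(𝓕 ∩ TJ⁻¹(𝒪_μ))`. -/
def reducedF (y : OrbitReduced G S.J μ) : Submodule ℝ (TangentSpace 𝓘(ℝ, EP) y) :=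
  Submodule.span ℝ {a | ∃ (s : OrbitLevel G S.J μ) (v : TangentSpace 𝓘(ℝ, ES) s),
    inclDeriv s v ∈ pullbackDistribution S.D s.pt ∧
    (⟨orbitProj s, orbitProjDeriv s v⟩ : TangentBundle 𝓘(ℝ, EP) (OrbitReduced G S.J μ)) = ⟨y, a⟩}

/-- The reduced distribution `𝓚_{𝒪_μ} = 𝓕_{𝒪_μ} ∩ TM_{𝒪_μ}`. -/
def reducedK (y : OrbitReduced G S.J μ) : Submodule ℝ (TangentSpace 𝓘(ℝ, EP) y) :=
  S.reducedF ES y ⊓ tangentOf 𝓘(ℝ, EP) (S.reducedM μ) y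

/-- The reduced Hamiltonian `h : (T*Q)_{𝒪_μ} → ℝ`, with `h ∘ π = H ∘ i`. -/
def reducedH : OrbitReduced G S.J μ → ℝ := reducedFunction S.H S.H_invariant

/-- `X` is the reduced dynamical vector field `X_{𝓚_{𝒪_μ}}`: it takes values in `𝓚_{𝒪_μ}` and
solves `i_X ω_{𝓚_{𝒪_μ}} = dh_{𝓚_{𝒪_μ}}` along `M_{𝒪_μ}`. -/
def IsReducedField (ωO : ∀ y : OrbitReduced G S.J μ,
    TangentSpace 𝓘(ℝ, EP) y →L[ℝ] TangentSpace 𝓘(ℝ, EP) y →L[ℝ] ℝ)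
    (X : ∀ y : OrbitReduced G S.J μ, TangentSpace 𝓘(ℝ, EP) y) : Prop :=
  ∀ y ∈ S.reducedM μ, X y ∈ S.reducedK ES y ∧
    ∀ w ∈ S.reducedK ES y, ωO y (X y) w = mfderiv 𝓘(ℝ, EP) 𝓘(ℝ, ℝ) S.reducedH y w

/-- The projection `τ_{𝓚_{𝒪_μ}} : T_y (T*Q)_{𝒪_μ} → 𝓚_{𝒪_μ}(y)`. -/
def reducedTau (ωO : ∀ y : OrbitReduced G S.J μ,
    TangentSpace 𝓘(ℝ, EP) y →L[ℝ] TangentSpace 𝓘(ℝ, EP) y →L[ℝ] ℝ)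
    (y : OrbitReduced G S.J μ) (v : TangentSpace 𝓘(ℝ, EP) y) : TangentSpace 𝓘(ℝ, EP) y :=
  formProjection (fun a b => ωO y a b) (S.reducedK ES y) v

variable {ES}

/-- A point `z` of `M ∩ J⁻¹(𝒪_μ)`, as a point of `J⁻¹(𝒪_μ)`. -/
def toLevel (z : Cotangent E Q) (hz : z ∈ S.constraintLevel μ) : OrbitLevel G S.J μ := ⟨z, hz.2⟩

/-- `γ̄ = π ∘ γ : Q → (T*Q)_{𝒪_μ}`. -/
def gammaBar (γ : ∀ q : Q, TangentSpace 𝓘(ℝ, E) q →L[ℝ] ℝ)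
    (hγ : ∀ q, formMap γ q ∈ S.constraintLevel μ) (q : Q) : OrbitReduced G S.J μ :=
  orbitProj (S.toLevel (formMap γ q) (hγ q))

/-- `λ̄ = π ∘ λ`, where `λ = γ ∘ π_Q : T*Q → T*Q`. -/
def lambdaBar (γ : ∀ q : Q, TangentSpace 𝓘(ℝ, E) q →L[ℝ] ℝ)
    (hγ : ∀ q, formMap γ q ∈ S.constraintLevel μ) (z : Cotangent E Q) : OrbitReduced G S.J μ :=
  orbitProj (S.toLevel (formMap γ (cotProj z)) (hγ (cotProj z)))

end NonholonomicSystem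

end Symmetry

end NonholonomicRCH

end

open NonholonomicRCH

/-! Since `λ̄ = γ̄ ∘ π_Q`, the chain rule turns the left side of the Type II equation into `Tλ̄ · X̃
· ε`, the right side of the other equation. What remains is a statement free of `γ`, `F` and `u`:
along `M ∩ J⁻¹(𝒪_μ)` the vector `Tε · X_f` is tangent to `J⁻¹(𝒪_μ)`, and its image `Tε̄ · X_f`
projects to `X_{𝓚_{𝒪_μ}}` under `τ`.

Tangency is Noether's theorem: `f` is constant on the orbit of such a point and `ε` is symplectic
and equivariant, so `TJ` kills `Tε · X_f` (`momentumDeriv_mfderiv_eq_zero`).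

For the projection, let `w` be tangent to `J⁻¹(𝒪_μ)` at `ε z` and choose `w'` at `z` with `Tε w' =
Ti w`. Because `TJ` vanishes on `Tε · X_f`, the orbit term drops out of the reduced form, and
`ωO(Tε̄ X_f, Tπ w) = ω(Tε X_f, Tε w') = ω(X_f, w') = df(w') = dh(Tπ w)`. On `𝓚_{𝒪_μ}` this is the
equation that defines the reduced field, and non-degeneracy there concludes (`formProjection_eq`).
The equality `df(w') = dh(Tπ w)` is delicate, as `f` is prescribed only on `ε⁻¹(J⁻¹(𝒪_μ))`;
`exists_lift_mfderiv_eq` handles it by a local inverse of `ε`. -/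

namespace NonholonomicRCH

/-! ### Local sections of submersions and local inverses. -/

section Differential

/-- A submersion has a smooth local section through each point. -/
theorem exists_local_section {V : Type*} [NormedAddCommGroup V] [NormedSpace ℝ V]
    {V' : Type*} [NormedAddCommGroup V'] [NormedSpace ℝ V']
    {M : Type*} [TopologicalSpace M] [ChartedSpace V M] [IsManifold 𝓘(ℝ, V) ∞ M]
    {N : Type*} [TopologicalSpace N] [ChartedSpace V' N] [IsManifold 𝓘(ℝ, V') ∞ N]
    {f : M → N} {x : M} (hf : Manifold.IsSubmersionAt 𝓘(ℝ, V) 𝓘(ℝ, V') ∞ f x) :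
    ∃ σ : N → M, σ (f x) = x ∧ ContMDiffAt 𝓘(ℝ, V') 𝓘(ℝ, V) ∞ σ (f x) ∧
      ∀ᶠ y in 𝓝 (f x), f (σ y) = y := by
  set φ := hf.domChart
  set ψ := hf.codChart
  set e := hf.equiv
  have hx : x ∈ φ.source := hf.mem_domChart_source
  have hy : f x ∈ ψ.source := hf.mem_codChart_source
  have hloc : ∀ p ∈ φ.target, ψ (f (φ.symm p)) = (e p).1 := fun p hp => by
    have h : p ∈ (φ.extend 𝓘(ℝ, V)).target := by simpa using hp
    simpa using hf.writtenInCharts h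
  have hfx : (e (φ x)).1 = ψ (f x) := by
    rw [← hloc _ (φ.map_source hx), φ.left_inv hx]
  -- In adapted charts `f` is the first projection; the section freezes the second coordinate at its
  -- value at `x`.
  let τ : V' → V := fun q => e.symm (q, (e (φ x)).2)
  have hτx : τ (ψ (f x)) = φ x := by
    simp only [τ, ← hfx, e.symm_apply_apply]
  have hτ : ContDiff ℝ ∞ τ := e.symm.contDiff.comp (contDiff_id.prodMk contDiff_const)
  have hψ : ContMDiffAt 𝓘(ℝ, V') 𝓘(ℝ, V') ∞ ψ (f x) :=
    contMDiffAt_of_mem_maximalAtlas hf.codChart_mem_maximalAtlas hy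
  have hφ : ContMDiffAt 𝓘(ℝ, V) 𝓘(ℝ, V) ∞ φ.symm (φ x) :=
    contMDiffAt_symm_of_mem_maximalAtlas hf.domChart_mem_maximalAtlas (φ.map_source hx)
  have hτψ : ContMDiffAt 𝓘(ℝ, V') 𝓘(ℝ, V) ∞ (fun y => τ (ψ y)) (f x) :=
    hτ.contMDiff.contMDiffAt.comp (f x) hψ
  refine ⟨fun y => φ.symm (τ (ψ y)), ?_, ?_, ?_⟩
  · simp only [hτx, φ.left_inv hx]
  · exact ContMDiffAt.comp (f x) (g := φ.symm) (by simpa only [hτx] using hφ) hτψ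
  · have h1 : ∀ᶠ y in 𝓝 (f x), τ (ψ y) ∈ φ.target :=
      hτψ.continuousAt.eventually_mem
        (φ.open_target.mem_nhds (by simpa only [hτx] using φ.map_source hx))
    filter_upwards [h1, ψ.open_source.mem_nhds hy] with y hy1 hy2
    refine ψ.injOn (hf.source_subset_preimage_source (φ.map_target hy1)) hy2 ?_
    rw [hloc _ hy1]
    simp [τ]

section Submersion

variable {V : Type*} [NormedAddCommGroup V] [NormedSpace ℝ V]
  {V' : Type*} [NormedAddCommGroup V'] [NormedSpace ℝ V']
  {M : Type*} [TopologicalSpace M] [ChartedSpace V M] [IsManifold 𝓘(ℝ, V) ∞ M]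
  {N : Type*} [TopologicalSpace N] [ChartedSpace V' N] [IsManifold 𝓘(ℝ, V') ∞ N]
  {f : M → N} {x : M}

theorem surjective_mfderiv_of_isSubmersionAt
    (hf : Manifold.IsSubmersionAt 𝓘(ℝ, V) 𝓘(ℝ, V') ∞ f x) :
    Function.Surjective (mfderiv 𝓘(ℝ, V) 𝓘(ℝ, V') f x) := by
  obtain ⟨σ, hσx, hσ, hfσ⟩ := exists_local_section hf
  have hd := hf.contMDiffAt.mdifferentiableAt (by simp)
  -- Replacing `x` by `σ y` avoids any transport between the tangent spaces at `x` and at `σ (f x)`.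
  generalize f x = y at hσx hσ hfσ
  subst hσx
  intro a
  refine ⟨mfderiv 𝓘(ℝ, V') 𝓘(ℝ, V) σ y a, ?_⟩
  have h1 : mfderiv 𝓘(ℝ, V') 𝓘(ℝ, V') (f ∘ σ) y = mfderiv 𝓘(ℝ, V') 𝓘(ℝ, V') id y :=
    Filter.EventuallyEq.mfderiv_eq hfσ
  have h2 := mfderiv_comp y hd (hσ.mdifferentiableAt (by simp))
  have h3 := congrArg (fun A : V' →L[ℝ] V' => A a) (h2.symm.trans (h1.trans mfderiv_id))
  exact h3

/-- Near `f x`, `h = (h ∘ f) ∘ σ` for a local section `σ`. This gives differentiability of the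
reduced Hamiltonian, of which only the pullback `H ∘ i` is known to be smooth. -/
theorem mdifferentiableAt_of_comp_isSubmersionAt
    (hf : Manifold.IsSubmersionAt 𝓘(ℝ, V) 𝓘(ℝ, V') ∞ f x) {h : N → ℝ}
    (hh : MDifferentiableAt 𝓘(ℝ, V) 𝓘(ℝ, ℝ) (h ∘ f) x) :
    MDifferentiableAt 𝓘(ℝ, V') 𝓘(ℝ, ℝ) h (f x) := by
  obtain ⟨σ, hσx, hσ, hfσ⟩ := exists_local_section hf
  have hd : MDifferentiableAt 𝓘(ℝ, V') 𝓘(ℝ, ℝ) ((h ∘ f) ∘ σ) (f x) :=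
    MDifferentiableAt.comp (f x) (by rwa [hσx]) (hσ.mdifferentiableAt (by simp))
  refine hd.congr_of_eventuallyEq ?_
  filter_upwards [hfσ] with y hy
  simp [hy]

end Submersion

/-- The inverse function theorem: a smooth map with invertible differential has a differentiable
local right inverse. -/
theorem exists_local_right_inverse
    {V : Type*} [NormedAddCommGroup V] [NormedSpace ℝ V] [CompleteSpace V]
    {H : Type*} [TopologicalSpace H] {I : ModelWithCorners ℝ V H} [I.Boundaryless]
    {M : Type*} [TopologicalSpace M] [ChartedSpace H M] [IsManifold I ∞ M]
    {e : M → M} {x : M} (he : ContMDiffAt I I ∞ e x)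
    (hb : Function.Bijective (mfderiv I I e x)) :
    ∃ g : M → M, g (e x) = x ∧ MDifferentiableAt I I g (e x) ∧ ∀ᶠ y in 𝓝 (e x), e (g y) = y := by
  have : IsManifold I 1 M := .of_le (n := ∞) (by exact_mod_cast le_top)
  set φ := extChartAt I x
  set ψ := extChartAt I (e x)
  let w : V → V := writtenInExtChartAt I I x e
  have hw : ContDiffAt ℝ ∞ w (φ x) := by
    have := (contMDiffAt_iff.1 he).2
    rwa [I.range_eq_univ, contDiffWithinAt_univ] at this
  have hd : mfderiv I I e x = fderiv ℝ w (φ x) := by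
    rw [(he.mdifferentiableAt (by simp)).mfderiv, I.range_eq_univ, fderivWithin_univ]
  -- Continuity of the inverse is the open mapping theorem, hence the completeness of `V`.
  let A : V ≃L[ℝ] V := ContinuousLinearEquiv.ofBijective (fderiv ℝ w (φ x))
    (LinearMap.ker_eq_bot.2 (by rw [← hd]; exact hb.1))
    (LinearMap.range_eq_top.2 (by rw [← hd]; exact hb.2))
  have hA : HasFDerivAt w (A : V →L[ℝ] V) (φ x) := by
    rw [ContinuousLinearEquiv.coe_ofBijective]
    exact (hw.differentiableAt (by simp)).hasFDerivAt
  have hs : HasStrictFDerivAt w (A : V →L[ℝ] V) (φ x) := hw.hasStrictFDerivAt' hA (by simp)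
  set l := hs.localInverse w A (φ x)
  have hwx : w (φ x) = ψ (e x) := by simp [w, writtenInExtChartAt, φ, ψ]
  have hlx : l (ψ (e x)) = φ x := by rw [← hwx]; exact hs.localInverse_apply_image
  have hl : HasStrictFDerivAt l (A.symm : V →L[ℝ] V) (ψ (e x)) := by
    rw [← hwx]; exact hs.to_localInverse
  have hψ : MDifferentiableAt I 𝓘(ℝ, V) ψ (e x) :=
    (contMDiffAt_extChartAt (n := 1)).mdifferentiableAt (by simp)
  have hφ : MDifferentiableAt 𝓘(ℝ, V) I φ.symm (φ x) := by
    have := (contMDiffOn_extChartAt_symm (I := I) (n := 1) x).contMDiffAt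
      (extChartAt_target_mem_nhds (I := I) x)
    exact this.mdifferentiableAt (by simp)
  have hlψ : MDifferentiableAt I 𝓘(ℝ, V) (fun y => l (ψ y)) (e x) :=
    hl.differentiableAt.mdifferentiableAt.comp (e x) hψ
  refine ⟨fun y => φ.symm (l (ψ y)), by simp [hlx, φ], ?_, ?_⟩
  · exact MDifferentiableAt.comp (e x) (g := φ.symm) (by simpa only [hlx] using hφ) hlψ
  · have hφx : φ.symm (l (ψ (e x))) = x := by simp [hlx, φ]
    have hc : ContinuousAt (fun y => φ.symm (l (ψ y))) (e x) :=
      ContinuousAt.comp (g := φ.symm) (by simpa only [hlx] using hφ.continuousAt) hlψ.continuousAt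
    -- The identity `w ∘ l = id` lives in the chart; it descends to the manifold where `ψ` is
    -- injective.
    have h1 : ∀ᶠ y in 𝓝 (e x), e (φ.symm (l (ψ y))) ∈ ψ.source := by
      refine ContinuousAt.eventually_mem
        (ContinuousAt.comp (g := e) (by rw [hφx]; exact he.continuousAt) hc) ?_
      rw [Function.comp_apply, hφx]
      exact extChartAt_source_mem_nhds (I := I) (e x)
    have h2 : ∀ᶠ y in 𝓝 (e x), w (l (ψ y)) = ψ y := by
      have := hs.eventually_right_inverse
      rw [hwx] at this
      exact hψ.continuousAt.eventually this
    filter_upwards [h1, h2, extChartAt_source_mem_nhds (I := I) (e x)] with y hy1 hy2 hy3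
    exact ψ.injOn hy1 hy3 hy2

/-- If `f = h ∘ e` at the points that the local diffeomorphism `e` maps to the immersed
submanifold `p`, then `df` and `d(h ∘ p)` agree on vectors that correspond under `e` and `p`. -/
theorem exists_lift_mfderiv_eq
    {V : Type*} [NormedAddCommGroup V] [NormedSpace ℝ V] [CompleteSpace V]
    {H : Type*} [TopologicalSpace H] {I : ModelWithCorners ℝ V H} [I.Boundaryless]
    {M : Type*} [TopologicalSpace M] [ChartedSpace H M] [IsManifold I ∞ M]
    {V' : Type*} [NormedAddCommGroup V'] [NormedSpace ℝ V']
    {P : Type*} [TopologicalSpace P] [ChartedSpace V' P]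
    {e : M → M} {p : P → M} {f h : M → ℝ} {x : M} {s : P} (hs : e x = p s)
    (he : ContMDiff I I ∞ e) (hb : Function.Bijective (mfderiv I I e x))
    (hp : MDifferentiableAt 𝓘(ℝ, V') I p s) (hf : MDifferentiable I 𝓘(ℝ, ℝ) f)
    (hfh : ∀ (y : M) (t : P), p t = e y → f y = h (p t)) (w : TangentSpace 𝓘(ℝ, V') s) :
    ∃ w' : TangentSpace I x, mfderiv I I e x w' = mfderiv 𝓘(ℝ, V') I p s w ∧
      mfderiv I 𝓘(ℝ, ℝ) f x w' = mfderiv 𝓘(ℝ, V') 𝓘(ℝ, ℝ) (fun t => h (p t)) s w := by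
  obtain ⟨g, hgx, hg, heg⟩ := exists_local_right_inverse he.contMDiffAt hb
  rw [hs] at hgx hg heg
  subst hgx
  have hgp : MDifferentiableAt 𝓘(ℝ, V') I (g ∘ p) s := hg.comp s hp
  have hpe : ∀ᶠ t in 𝓝 s, e (g (p t)) = p t := hp.continuousAt.eventually heg
  -- Near `s`, the map `g ∘ p` takes values in points that `e` sends into the image of `p`, and
  -- these are the points where `f` is known. So `f ∘ g ∘ p` and `h ∘ p` have the same germ,
  -- although `f` is not determined on an open set.
  refine ⟨mfderiv 𝓘(ℝ, V') I (g ∘ p) s w, ?_, ?_⟩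
  · have h1 : mfderiv 𝓘(ℝ, V') I (e ∘ g ∘ p) s = mfderiv 𝓘(ℝ, V') I p s :=
      Filter.EventuallyEq.mfderiv_eq hpe
    have h2 := mfderiv_comp s ((he.mdifferentiable (by simp)).mdifferentiableAt) hgp
    rw [← h1, h2]
    rfl
  · have h1 : mfderiv 𝓘(ℝ, V') 𝓘(ℝ, ℝ) (f ∘ g ∘ p) s =
        mfderiv 𝓘(ℝ, V') 𝓘(ℝ, ℝ) (fun t => h (p t)) s := by
      refine Filter.EventuallyEq.mfderiv_eq ?_
      filter_upwards [hpe] with t ht using hfh _ _ ht.symm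
    have h2 := mfderiv_comp s (hf _) hgp
    rw [← h1, h2]
    rfl

end Differential

/-! ### Adjoint and coadjoint actions. -/

section LieGroup

variable {EG : Type*} [NormedAddCommGroup EG] [NormedSpace ℝ EG]
  {G : Type*} [Group G] [TopologicalSpace G] [ChartedSpace EG G] [LieGroup 𝓘(ℝ, EG) ∞ G]

theorem adjoint_mul (g h : G) :
    (adjoint (g * h) : EG →L[ℝ] EG) = (adjoint g).comp (adjoint h) := by
  have hd (k x : G) : MDifferentiableAt 𝓘(ℝ, EG) 𝓘(ℝ, EG) (fun a : G => k * a * k⁻¹) x :=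
    (((contMDiff_mul_right (I := 𝓘(ℝ, EG)) (n := ∞) (a := k⁻¹)).comp
      (contMDiff_mul_left (I := 𝓘(ℝ, EG)) (n := ∞) (a := k))).mdifferentiable (by simp)) x
  have hcomp : (fun a : G => g * h * a * (g * h)⁻¹) =
      (fun a : G => g * a * g⁻¹) ∘ fun a : G => h * a * h⁻¹ := by
    funext a
    simp [mul_assoc]
  have key := mfderiv_comp (1 : G) (hd g (h * 1 * h⁻¹)) (hd h 1)
  rw [← hcomp] at key
  have h1 : h * 1 * h⁻¹ = 1 := by simp
  -- The chain rule yields the derivative at `h * 1 * h⁻¹`, which equals `1` only propositionally.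
  have base : ∀ x : G, x = 1 →
      (mfderiv 𝓘(ℝ, EG) 𝓘(ℝ, EG) (fun a : G => g * a * g⁻¹) x : EG →L[ℝ] EG) =
        mfderiv 𝓘(ℝ, EG) 𝓘(ℝ, EG) (fun a : G => g * a * g⁻¹) 1 := by
    rintro x rfl
    rfl
  unfold adjoint
  refine key.trans ?_
  exact congrArg (fun A : EG →L[ℝ] EG =>
    A.comp (mfderiv 𝓘(ℝ, EG) 𝓘(ℝ, EG) (fun a : G => h * a * h⁻¹) 1 : EG →L[ℝ] EG)) (base _ h1)

theorem coadjoint_mem_coadjointOrbit (g : G) {μ ν : EG →L[ℝ] ℝ}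
    (hν : ν ∈ coadjointOrbit G μ) : coadjoint g ν ∈ coadjointOrbit G μ := by
  obtain ⟨k, rfl⟩ := hν
  exact ⟨g * k, by simp [coadjoint, adjoint_mul, ContinuousLinearMap.comp_assoc]⟩

theorem orbitForm_zero_left [CompleteSpace EG] (ν : EG →L[ℝ] ℝ)
    (η : GroupLieAlgebra 𝓘(ℝ, EG) G) : orbitForm ν 0 η = 0 := by
  -- This is the smoothness under which the bracket on `GroupLieAlgebra` is a Lie ring structure.
  have : LieGroup 𝓘(ℝ, EG) (minSmoothness ℝ 3) G := by
    rw [minSmoothness_of_isRCLikeNormedField]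
    exact .of_le (n := ∞) (WithTop.coe_le_coe.2 le_top)
  rw [orbitForm, zero_lie]
  exact map_zero ν

end LieGroup

/-! ### Linear algebra of the canonical form. -/

section Cotangent

variable {E : Type*} [NormedAddCommGroup E] [NormedSpace ℝ E]
  {Q : Type*} [TopologicalSpace Q] [ChartedSpace E Q] [IsManifold 𝓘(ℝ, E) ∞ Q]

theorem eq_zero_of_canonicalForm_eq_zero {z : Cotangent E Q} {v : TangentSpace (cotModel E) z}
    (h : ∀ w, canonicalForm z v w = 0) : v = 0 := by
  obtain ⟨a, b⟩ : E × (E →L[ℝ] ℝ) := v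
  have h1 : ∀ (c : E) (p : E →L[ℝ] ℝ), p a - b c = 0 := fun c p => h (c, p)
  have hb : b = 0 := by
    ext c
    simpa using h1 c 0
  have ha : a = 0 := by
    by_contra hne
    -- Hahn–Banach provides a covector `p` with `p a = ‖a‖`; the test vector `(0, p)` then detects
    -- `a`.
    obtain ⟨p, -, hp⟩ := exists_dual_vector ℝ a (by simpa using hne)
    have h2 := h1 0 p
    rw [map_zero, sub_zero, hp] at h2
    exact hne (by simpa using h2)
  rw [ha, hb]
  rfl

theorem canonicalForm_swap (z : Cotangent E Q) (v w : TangentSpace (cotModel E) z) :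
    canonicalForm z v w = -canonicalForm z w v := by
  simp [canonicalForm]

/-- A vector killed by `Tε` is `ω`-orthogonal to everything because `ε^*ω = ω`, so it is zero;
finite dimension gives surjectivity. -/
theorem IsSymplecticMap.bijective_mfderiv [FiniteDimensional ℝ E]
    {ε : Cotangent E Q → Cotangent E Q} (hε : IsSymplecticMap ε) (z : Cotangent E Q) :
    Function.Bijective (mfderiv (cotModel E) (cotModel E) ε z) := by
  let A : E × (E →L[ℝ] ℝ) →ₗ[ℝ] E × (E →L[ℝ] ℝ) :=
    (mfderiv (cotModel E) (cotModel E) ε z : E × (E →L[ℝ] ℝ) →L[ℝ] E × (E →L[ℝ] ℝ)).toLinearMap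
  have hinj : Function.Injective (mfderiv (cotModel E) (cotModel E) ε z) := by
    refine (injective_iff_map_eq_zero (A : E × (E →L[ℝ] ℝ) →ₗ[ℝ] E × (E →L[ℝ] ℝ))).2 fun v hv => ?_
    change mfderiv (cotModel E) (cotModel E) ε z v = (0 : E × (E →L[ℝ] ℝ)) at hv
    refine eq_zero_of_canonicalForm_eq_zero (z := z) fun w => ?_
    rw [← hε.2 z v w, hv]
    change (_ : E →L[ℝ] ℝ) 0 - (0 : E →L[ℝ] ℝ) _ = 0
    simp
  exact ⟨hinj, (LinearMap.injective_iff_surjective (f := A)).1  hinj⟩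

theorem mdifferentiable_cotProj :
    MDifferentiable (cotModel E) 𝓘(ℝ, E) (cotProj : Cotangent E Q → Q) :=
  (Bundle.contMDiff_proj (n := ∞) (IB := 𝓘(ℝ, E))
    (fun q : Q => TangentSpace 𝓘(ℝ, E) q →L[ℝ] Bundle.Trivial Q ℝ q)).mdifferentiable (by simp)

end Cotangent

/-! ### Infinitesimal generators, Noether's theorem, and one-forms with values in the level set. -/

section Symmetry

variable {E : Type*} [NormedAddCommGroup E] [NormedSpace ℝ E]
  {Q : Type*} [TopologicalSpace Q] [ChartedSpace E Q] [IsManifold 𝓘(ℝ, E) ∞ Q]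
  {EG : Type*} [NormedAddCommGroup EG] [NormedSpace ℝ EG]
  {G : Type*} [Group G] [TopologicalSpace G] [ChartedSpace EG G] [MulAction G Q]

omit [IsManifold 𝓘(ℝ, E) ∞ Q] [TopologicalSpace G] in
theorem cotLift_one (z : Cotangent E Q) : cotLift (1 : G) z = z := by
  obtain ⟨q, p⟩ := z
  -- Abstracting the map `x ↦ 1 • x` lets the base point and the derivative change together.
  have key : ∀ φ : Q → Q, φ = id →
      (⟨φ q, p.comp (mfderiv 𝓘(ℝ, E) 𝓘(ℝ, E) φ q).inverse⟩ : Cotangent E Q) = ⟨q, p⟩ := by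
    rintro _ rfl
    rw [mfderiv_id]
    change (⟨q, ContinuousLinearMap.comp p (ContinuousLinearMap.id ℝ _).inverse⟩ :
      Cotangent E Q) = _
    rw [ContinuousLinearMap.inverse_id]
    rfl
  exact key (fun x => (1 : G) • x) (funext fun x => one_smul G x)

theorem coadjointGenerator_zero (ν : EG →L[ℝ] ℝ) :
    coadjointGenerator (G := G) (0 : GroupLieAlgebra 𝓘(ℝ, EG) G) ν = 0 :=
  map_zero (mfderiv 𝓘(ℝ, EG) 𝓘(ℝ, EG →L[ℝ] ℝ) (fun g : G => coadjoint g ν) 1)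

namespace NonholonomicSystem

theorem mdifferentiable_orbitMap (S : NonholonomicSystem E Q EG G) (z : Cotangent E Q) :
    MDifferentiable 𝓘(ℝ, EG) (cotModel E) (fun g : G => cotLift g z) :=
  (S.lift_smooth.comp (contMDiff_id.prodMk contMDiff_const)).mdifferentiable (by simp)

/-- The chain rule for the orbit map at the identity of `G`. Equivariance of `ε` and invariance of
`f` both enter infinitesimally through it. -/
theorem mfderiv_apply_generator (S : NonholonomicSystem E Q EG G)
    {V : Type*} [NormedAddCommGroup V] [NormedSpace ℝ V]
    {H : Type*} [TopologicalSpace H] {I : ModelWithCorners ℝ V H}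
    {N : Type*} [TopologicalSpace N] [ChartedSpace H N]
    {f : Cotangent E Q → N} (hf : MDifferentiable (cotModel E) I f) (z : Cotangent E Q)
    (ξ : GroupLieAlgebra 𝓘(ℝ, EG) G) :
    mfderiv (cotModel E) I f z (generator ξ z) =
      mfderiv 𝓘(ℝ, EG) I (fun g : G => f (cotLift g z)) 1 ξ := by
  have h := mfderiv_comp (1 : G) (hf (cotLift (1 : G) z)) (S.mdifferentiable_orbitMap z 1)
  have base : ∀ z' : Cotangent E Q, z' = z → ∀ v : E × (E →L[ℝ] ℝ),
      (mfderiv (cotModel E) I f z' v : V) = mfderiv (cotModel E) I f z v := by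
    rintro _ rfl v
    rfl
  have h1 := congrArg (fun A : EG →L[ℝ] V => A ξ) h
  exact (base _ (cotLift_one z) _).symm.trans h1.symm

theorem mfderiv_generator_of_equivariant (S : NonholonomicSystem E Q EG G)
    {ε : Cotangent E Q → Cotangent E Q} (hε : MDifferentiable (cotModel E) (cotModel E) ε)
    (hinv : ∀ (g : G) (z : Cotangent E Q), ε (cotLift g z) = cotLift g (ε z))
    (z : Cotangent E Q) (ξ : GroupLieAlgebra 𝓘(ℝ, EG) G) :
    mfderiv (cotModel E) (cotModel E) ε z (generator ξ z) = generator ξ (ε z) := by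
  rw [S.mfderiv_apply_generator hε]
  have h : (fun g : G => ε (cotLift g z)) = fun g : G => cotLift g (ε z) :=
    funext fun g => hinv g z
  unfold generator
  rw [h]
  rfl

theorem mfderiv_generator_of_invariant (S : NonholonomicSystem E Q EG G)
    {f : Cotangent E Q → ℝ} (hf : MDifferentiable (cotModel E) 𝓘(ℝ, ℝ) f) {z : Cotangent E Q}
    (hinv : ∀ g : G, f (cotLift g z) = f z) (ξ : GroupLieAlgebra 𝓘(ℝ, EG) G) :
    (mfderiv (cotModel E) 𝓘(ℝ, ℝ) f z (generator ξ z) : ℝ) = 0 := by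
  rw [S.mfderiv_apply_generator hf]
  have h : (fun g : G => f (cotLift g z)) = fun _ => f z := funext hinv
  rw [h, mfderiv_const]
  rfl

/-- For a function `f` that is constant on the orbit of `z`, the momentum map is constant to first
order along the image under `ε` of the Hamiltonian vector field of `f` at `z`. -/
theorem momentumDeriv_mfderiv_eq_zero (S : NonholonomicSystem E Q EG G)
    {ε : Cotangent E Q → Cotangent E Q} (hε : IsSymplecticMap ε)
    (hε_inv : ∀ (g : G) (z : Cotangent E Q), ε (cotLift g z) = cotLift g (ε z))
    {f : Cotangent E Q → ℝ} (hf : MDifferentiable (cotModel E) 𝓘(ℝ, ℝ) f) {z : Cotangent E Q}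
    (hinv : ∀ g : G, f (cotLift g z) = f z)
    {X : ∀ z : Cotangent E Q, TangentSpace (cotModel E) z} (hX : IsHamiltonianField f X) :
    momentumDeriv S.J (ε z) (mfderiv (cotModel E) (cotModel E) ε z (X z)) = 0 := by
  refine ContinuousLinearMap.ext fun (ξ : GroupLieAlgebra 𝓘(ℝ, EG) G) => ?_
  refine (S.J_momentum ξ _ _).trans ?_
  change canonicalForm (ε z) (generator ξ (ε z)) _ = (0 : ℝ)
  -- With `ξ_{T*Q}(ε z) = Tε ξ_{T*Q}(z)`, the pairing becomes `ω(ξ_{T*Q}, X) = -df(ξ_{T*Q}) = 0`.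
  rw [← S.mfderiv_generator_of_equivariant (hε.1.mdifferentiable (by simp)) hε_inv, hε.2,
    canonicalForm_swap, hX, S.mfderiv_generator_of_invariant hf hinv]
  exact neg_zero (G := ℝ)

/-- A smooth one-form with values in `J⁻¹(𝒪_μ)` is smooth as a map to `J⁻¹(𝒪_μ)`. -/
theorem mdifferentiable_toLevel_formMap [FiniteDimensional ℝ E] (S : NonholonomicSystem E Q EG G)
    {μ : EG →L[ℝ] ℝ}
    {ES : Type*} [NormedAddCommGroup ES] [NormedSpace ℝ ES]
    [TopologicalSpace (OrbitLevel G S.J μ)] [ChartedSpace ES (OrbitLevel G S.J μ)]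
    (hlevel : IsLevelSubmanifold G S.J μ ES)
    {γ : ∀ q : Q, TangentSpace 𝓘(ℝ, E) q →L[ℝ] ℝ}
    (hγ_smooth : ContMDiff 𝓘(ℝ, E) (cotModel E) ∞ (formMap γ))
    (hγ : ∀ q, formMap γ q ∈ S.constraintLevel μ) :
    MDifferentiable 𝓘(ℝ, E) 𝓘(ℝ, ES) (fun q => S.toLevel (formMap γ q) (hγ q)) := by
  intro q
  have : IsManifold 𝓘(ℝ, E) 1 Q := .of_le (n := ∞) (by exact_mod_cast le_top)
  -- The initial-submanifold property is tested on open subsets of Euclidean spaces, so `γ` is read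
  -- there through a chart of `Q` and a linear isomorphism.
  let b : EuclideanSpace ℝ (Fin (Module.finrank ℝ E)) ≃L[ℝ] E :=
    ContinuousLinearEquiv.ofFinrankEq (by simp)
  let φ := chartAt E q
  have hU : IsOpen (b ⁻¹' φ.target) := φ.open_target.preimage b.continuous
  have hsmooth := hlevel.initial _ _ hU
    (fun x => S.toLevel (formMap γ (φ.symm (b x))) (hγ _))
    (hγ_smooth.comp_contMDiffOn
      ((contMDiffOn_chart_symm (I := 𝓘(ℝ, E)) (n := ∞) (x := q)).comp
        b.contDiff.contMDiff.contMDiffOn fun x hx => hx))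
  have hq : b.symm (φ q) ∈ b ⁻¹' φ.target := by
    simp [φ]
  have h1 := (hsmooth.contMDiffAt (hU.mem_nhds hq)).mdifferentiableAt (by simp)
  have h2 : MDifferentiableAt 𝓘(ℝ, E) 𝓘(ℝ, EuclideanSpace ℝ (Fin (Module.finrank ℝ E)))
      (fun y => b.symm (φ y)) q :=
    b.symm.differentiableAt.mdifferentiableAt.comp q
      (mdifferentiableAt_atlas (chart_mem_atlas E q) (mem_chart_source E q))
  refine (h1.comp q h2).congr_of_eventuallyEq ?_
  filter_upwards [φ.open_source.mem_nhds (mem_chart_source E q)] with y hy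
  simp [φ.left_inv hy]

end NonholonomicSystem

end Symmetry

/-- Two candidates for the projection differ by an element of `K` that is `B`-orthogonal to `K`,
hence by zero. -/
theorem formProjection_eq {V : Type*} [AddCommGroup V] [Module ℝ V] {B : V → V → ℝ}
    (hB : ∀ a b w, B (a - b) w = B a w - B b w) {K : Submodule ℝ V} (hK : NondegenerateOn B K)
    {v k : V} (hk : k ∈ K) (h : ∀ w ∈ K, B k w = B v w) : formProjection B K v = k := by
  have hex : ∃ k : V, k ∈ K ∧ ∀ w ∈ K, B k w = B v w := ⟨k, hk, h⟩
  rw [formProjection, dif_pos hex]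
  obtain ⟨h1, h2⟩ := hex.choose_spec
  refine sub_eq_zero.1 (hK _ (K.sub_mem h1 hk) fun w hw => ?_)
  rw [hB, h2 w hw, h w hw, sub_self]

end NonholonomicRCH

/-! ### The equivalence of the two equations. -/

theorem theorem5p11
    {E : Type*} [NormedAddCommGroup E] [NormedSpace ℝ E] [FiniteDimensional ℝ E]
    {Q : Type*} [TopologicalSpace Q] [ChartedSpace E Q] [IsManifold 𝓘(ℝ, E) ∞ Q]
    {EG : Type*} [NormedAddCommGroup EG] [NormedSpace ℝ EG] [FiniteDimensional ℝ EG]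
    {G : Type*} [Group G] [TopologicalSpace G] [ChartedSpace EG G] [LieGroup 𝓘(ℝ, EG) ∞ G]
    [MulAction G Q] [ContMDiffSMul 𝓘(ℝ, EG) 𝓘(ℝ, E) ∞ G Q]
    -- the system, the control law, and the connection used for the vertical lifts
    (S : NonholonomicSystem E Q EG G)
    (u : Cotangent E Q → Cotangent E Q) (hu : S.IsControlLaw u)
    (C : VerticalPart E Q)
    -- the regular value, and the smooth structures of `J⁻¹(𝒪_μ)` and `(T*Q)_{𝒪_μ}`
    (μ : EG →L[ℝ] ℝ) (hμ : IsRegularValue S.J μ)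
    {ES : Type*} [NormedAddCommGroup ES] [NormedSpace ℝ ES]
    [TopologicalSpace (OrbitLevel G S.J μ)] [ChartedSpace ES (OrbitLevel G S.J μ)]
    [IsManifold 𝓘(ℝ, ES) ∞ (OrbitLevel G S.J μ)]
    (hlevel : IsLevelSubmanifold G S.J μ ES)
    {EP : Type*} [NormedAddCommGroup EP] [NormedSpace ℝ EP]
    [TopologicalSpace (OrbitReduced G S.J μ)] [ChartedSpace EP (OrbitReduced G S.J μ)]
    [IsManifold 𝓘(ℝ, EP) ∞ (OrbitReduced G S.J μ)]
    (hproj : Manifold.IsSubmersion 𝓘(ℝ, ES) 𝓘(ℝ, EP) ∞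
      (orbitProj : OrbitLevel G S.J μ → OrbitReduced G S.J μ))
    -- the reduced symplectic form
    (ωO : ∀ y : OrbitReduced G S.J μ,
      TangentSpace 𝓘(ℝ, EP) y →L[ℝ] TangentSpace 𝓘(ℝ, EP) y →L[ℝ] ℝ)
    (hωO : IsReducedForm ES ωO)
    -- the system is reducible at `𝒪_μ`
    (hF : ∀ z, S.J z ∈ coadjointOrbit G μ → S.J (S.F z) ∈ coadjointOrbit G μ)
    (hW : ∃ z ∈ S.W, S.J z ∈ coadjointOrbit G μ)
    (hM : (S.constraintLevel μ).Nonempty)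
    -- the distributional RCH system
    (XH : ∀ z : Cotangent E Q, TangentSpace (cotModel E) z) (hXH : IsHamiltonianField S.H XH)
    (hK : ∀ z ∈ S.M, NondegenerateOn (canonicalForm z) (S.K z))
    (XK : ∀ z : Cotangent E Q, TangentSpace (cotModel E) z) (hXK : S.IsNonholonomicField XK)
    -- the reduced distributional RCH system
    (hKO : ∀ y ∈ S.reducedM μ, NondegenerateOn (fun a b => ωO y a b) (S.reducedK ES y))
    (XKO : ∀ y : OrbitReduced G S.J μ, TangentSpace 𝓘(ℝ, EP) y)
    (hXKO : S.IsReducedField ES ωO XKO)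
    -- the one-form
    (γ : ∀ q : Q, TangentSpace 𝓘(ℝ, E) q →L[ℝ] ℝ)
    (hγ_smooth : ContMDiff 𝓘(ℝ, E) (cotModel E) ∞ (formMap γ))
    (hγ : ∀ q, formMap γ q ∈ S.constraintLevel μ)
    (hγ_inv : ∀ (g : G) (q : Q), formMap γ (g • q) = cotLift g (formMap γ q))
    (hγ_K : ∀ (q : Q) (v : TangentSpace 𝓘(ℝ, E) q),
      mfderiv 𝓘(ℝ, E) 𝓘(ℝ, EP) (S.gammaBar γ hγ) q v ∈ S.reducedK ES (S.gammaBar γ hγ q))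
    -- the symplectic map
    (ε : Cotangent E Q → Cotangent E Q) (hε : IsSymplecticMap ε)
    (hε_inv : ∀ (g : G) (z : Cotangent E Q), ε (cotLift g z) = cotLift g (ε z))
    (hεM : ∀ z ∈ S.constraintLevel μ, ε z ∈ S.constraintLevel μ)
    -- the Hamiltonian vector field of the function `h ∘ ε̄`, where `ε̄ = π ∘ ε`
    (f : Cotangent E Q → ℝ) (hf_smooth : ContMDiff (cotModel E) 𝓘(ℝ, ℝ) ∞ f)
    (hf : ∀ (z : Cotangent E Q) (s : OrbitLevel G S.J μ), s.pt = ε z →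
      f z = S.reducedH (orbitProj s))
    (Xf : ∀ z : Cotangent E Q, TangentSpace (cotModel E) z) (hXf : IsHamiltonianField f Xf) :
    -- `τ · Tε̄ · X_{h ∘ ε̄} = Tλ̄ · X̃ · ε`; here `Tε̄ = Tπ · Tε`, so the vector `Tε · X_{h ∘ ε̄}`
    -- must be tangent to `J⁻¹(𝒪_μ)`
    (∀ (z : Cotangent E Q) (hz : z ∈ S.constraintLevel μ),
      ∃ v : TangentSpace 𝓘(ℝ, ES) (S.toLevel (ε z) (hεM z hz)),
        inclDeriv (S.toLevel (ε z) (hεM z hz)) v =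
          mfderiv (cotModel E) (cotModel E) ε z (Xf z) ∧
        (⟨orbitProj (S.toLevel (ε z) (hεM z hz)),
          S.reducedTau ES ωO (orbitProj (S.toLevel (ε z) (hεM z hz)))
            (orbitProjDeriv (S.toLevel (ε z) (hεM z hz)) v)⟩ :
          TangentBundle 𝓘(ℝ, EP) (OrbitReduced G S.J μ)) =
        tangentMap (cotModel E) 𝓘(ℝ, EP) (S.lambdaBar γ hγ)
          ⟨ε z, S.dynamicalField C u XH XK (ε z)⟩) ↔
    -- `Tγ̄ · X̃^ε = X_{𝓚_{𝒪_μ}} · ε̄`, where `X̃^ε = Tπ_Q · X̃ · ε`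
    (∀ (z : Cotangent E Q) (hz : z ∈ S.constraintLevel μ),
      tangentMap 𝓘(ℝ, E) 𝓘(ℝ, EP) (S.gammaBar γ hγ)
        (tangentMap (cotModel E) 𝓘(ℝ, E) cotProj
          ⟨ε z, S.dynamicalField C u XH XK (ε z)⟩) =
      (⟨orbitProj (S.toLevel (ε z) (hεM z hz)),
        XKO (orbitProj (S.toLevel (ε z) (hεM z hz)))⟩ :
        TangentBundle 𝓘(ℝ, EP) (OrbitReduced G S.J μ))) := by
  have hchain (z : Cotangent E Q) : tangentMap 𝓘(ℝ, E) 𝓘(ℝ, EP) (S.gammaBar γ hγ)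
      (tangentMap (cotModel E) 𝓘(ℝ, E) cotProj ⟨ε z, S.dynamicalField C u XH XK (ε z)⟩) =
      tangentMap (cotModel E) 𝓘(ℝ, EP) (S.lambdaBar γ hγ)
        ⟨ε z, S.dynamicalField C u XH XK (ε z)⟩ := by
    have hγd : MDifferentiable 𝓘(ℝ, E) 𝓘(ℝ, EP) (S.gammaBar γ hγ) :=
      (hproj.contMDiff.mdifferentiable (by simp)).comp
        (S.mdifferentiable_toLevel_formMap hlevel hγ_smooth hγ)
    exact (tangentMap_comp_at _ (hγd _) (mdifferentiable_cotProj _)).symm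
  have hHd : MDifferentiable (cotModel E) 𝓘(ℝ, ℝ) S.H := S.H_smooth.mdifferentiable (by simp)
  have hfd : MDifferentiable (cotModel E) 𝓘(ℝ, ℝ) f := hf_smooth.mdifferentiable (by simp)
  have hpt : MDifferentiable 𝓘(ℝ, ES) (cotModel E)
      (OrbitLevel.pt : OrbitLevel G S.J μ → Cotangent E Q) :=
    hlevel.immersion.contMDiff.mdifferentiable (by simp)
  have hfH (y : Cotangent E Q) (t : OrbitLevel G S.J μ) (ht : t.pt = ε y) : f y = S.H t.pt :=
    hf y t ht
  have hmom (z : Cotangent E Q) (hz : z ∈ S.constraintLevel μ) :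
      momentumDeriv S.J (ε z) (mfderiv (cotModel E) (cotModel E) ε z (Xf z)) = 0 := by
    refine S.momentumDeriv_mfderiv_eq_zero hε hε_inv hfd (fun g => ?_) hXf
    -- `f` is known only over the level set; the orbit of `ε z` stays inside it by equivariance of
    -- `J`.
    have hg : S.J (cotLift g (ε z)) ∈ coadjointOrbit G μ := by
      rw [S.J_equivariant]
      exact coadjoint_mem_coadjointOrbit g (hεM z hz).2
    rw [hfH _ ⟨_, hg⟩ (hε_inv g z).symm, hfH z ⟨_, (hεM z hz).2⟩ rfl, S.H_invariant]
  have hlift (z : Cotangent E Q) (hz : z ∈ S.constraintLevel μ) :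
      ∃ v : TangentSpace 𝓘(ℝ, ES) (S.toLevel (ε z) (hεM z hz)),
        inclDeriv (S.toLevel (ε z) (hεM z hz)) v =
          mfderiv (cotModel E) (cotModel E) ε z (Xf z) :=
    (hlevel.tangent (S.toLevel (ε z) (hεM z hz)) _).2
      -- Since `TJ` vanishes on the vector, `ξ = 0` witnesses tangency.
      ⟨0, by rw [coadjointGenerator_zero]; exact hmom z hz⟩
  have hτ (z : Cotangent E Q) (hz : z ∈ S.constraintLevel μ)
      (v : TangentSpace 𝓘(ℝ, ES) (S.toLevel (ε z) (hεM z hz)))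
      (hv : inclDeriv (S.toLevel (ε z) (hεM z hz)) v =
        mfderiv (cotModel E) (cotModel E) ε z (Xf z)) :
      S.reducedTau ES ωO (orbitProj (S.toLevel (ε z) (hεM z hz)))
        (orbitProjDeriv (S.toLevel (ε z) (hεM z hz)) v) =
      XKO (orbitProj (S.toLevel (ε z) (hεM z hz))) := by
    let s : OrbitLevel G S.J μ := S.toLevel (ε z) (hεM z hz)
    have hy : (orbitProj s : OrbitReduced G S.J μ) ∈ S.reducedM μ := ⟨s, (hεM z hz).1, rfl⟩
    refine formProjection_eq (fun a b w => by simp) (hKO _ hy) (hXKO _ hy).1 fun w hw => ?_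
    rw [(hXKO _ hy).2 w hw]
    -- Any lift of `w` to `J⁻¹(𝒪_μ)` will do; it need not lie in `𝓕` or be tangent to `M`.
    obtain ⟨w, rfl⟩ := surjective_mfderiv_of_isSubmersionAt (hproj.isSubmersionAt s) w
    obtain ⟨w', hw1, hw2⟩ := exists_lift_mfderiv_eq (s := s) (h := S.H) (x := z) rfl hε.1
      (hε.bijective_mfderiv z) (hpt s) hfd hfH w
    have hHh : mfderiv 𝓘(ℝ, ES) 𝓘(ℝ, ℝ) (fun t : OrbitLevel G S.J μ => S.H t.pt) s =
        (mfderiv 𝓘(ℝ, EP) 𝓘(ℝ, ℝ) S.reducedH (orbitProj s)).comp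
          (mfderiv 𝓘(ℝ, ES) 𝓘(ℝ, EP) orbitProj s) :=
      mfderiv_comp (g := S.reducedH) s
        (mdifferentiableAt_of_comp_isSubmersionAt (hproj.isSubmersionAt s)
          ((hHd _).comp s (hpt s)))
        ((hproj.contMDiff.mdifferentiable (by simp)) s)
    obtain ⟨η, hη⟩ := (hlevel.tangent s (inclDeriv s w)).1 ⟨w, rfl⟩
    -- Taking `ξ = 0` for `v` removes the orbit term whatever `η` belongs to `w`.
    have hform := hωO s v w 0 η
      (by rw [hv, coadjointGenerator_zero]; exact hmom z hz) hη
    rw [orbitForm_zero_left, add_zero, hv] at hform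
    refine Eq.trans ?_ hform
    have hw3 : inclDeriv s w = mfderiv (cotModel E) (cotModel E) ε z w' := hw1.symm
    rw [hw3]
    refine Eq.trans ?_ (hε.2 z (Xf z) w').symm
    rw [hXf z w', hw2, hHh]
    rfl
  constructor
  · intro h z hz
    obtain ⟨v, hv, heq⟩ := h z hz
    rw [hchain, ← heq, hτ z hz v hv]
  · intro h z hz
    obtain ⟨v, hv⟩ := hlift z hz
    refine ⟨v, hv, ?_⟩
    rw [hτ z hz v hv, ← h z hz, hchain]
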